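/- Let $\mathbb F_q\le\mathbb F_{q^a}\le\mathbb F_{q^m}$ be finite fields, $r=m/a$, let $n\ge 1$ be a multiple of $m$, and let $\sigma(x)=x^q$. Let $R=\mathbb F_{q^a}[X;\sigma]$ be the skew polynomial ring with $Xc=\sigma(c)X$, and put $P_n=R/(X^n-1)$ and $R_n=\mathbb F_{q^m}[X;\sigma]/(X^n-1)$. Let $\ell\ge 0$, let $\mathcal C$ be a left $P_n$-submodule of $R_n^\ell$ (an $\mathbb F_{q^a}$-linear skew quasi-cyclic code), and let $b_1,\dots,b_r$ be a basis of $\mathbb F_{q^m}$ over $\mathbb F_{q^a}$ (for example a normal basis). Let $\overline{r_1},\dots,\overline{r_k}\in\mathbb F_{q^m}[X;\sigma]^\ell$ be vectors whose classes in $R_n^\ell$ generate $\mathcal C$ as a $P_n$-module, and let $A\in R^{k\times r\ell}$ be the matrix of their coordinates with respect to the decomposition $\mathbb F_{q^m}[X;\sigma]=\bigoplus_{j=1}^r R\,b_j$ applied to each entry. Let $$M=\begin{pmatrix}A\\ (X^n-1)\,\mathrm{Id}_{r\ell}\end{pmatrix}\in R^{(k+r\ell)\times r\ell},$$ the generator matrix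 of the preimage $\pi^{-1}(\mathcal C)$ of $\mathcal C$ in $\mathbb F_{q^m}[X;\sigma]^\ell$. For $s,t\in R$, $s$ is a total divisor of $t$, written $s\mid\mid t$, if for all $u\in R$ we have $ut\in sR$ and $tu\in Rs$. A Smith normal form of a matrix $B$ over $R$ is a matrix $SBT=\operatorname{diag}(e_1,\dots,e_\rho,0,\dots,0)$ of the same size as $B$, with $S,T$ invertible over $R$, all $e_i\neq 0$, and $e_i\mid\mid e_{i+1}$ for $1\le i<\rho$. For $f,g\in R$ not both zero, $\operatorname{gcrd}(f,g)$ is their monic greatest common right divisor. 1. For every Smith normal form $SMT=\operatorname{diag}(h_1,\dots,h_\rho,0,\dots,0)$ of $M$ we have $\rho=r\ell$, and each $h_i$ is a total divisor of $X^n-1$ in $R$. In particular, for each $i$ there is $d_i\in R$ with $h_id_i=d_ih_i=X^n-1$. 2. For every Smith normal form $\overline S A\,\overline T=\operatorname{diag}(a_1,\dots,a_\kappa,0,\dots,0)$ of $A$, the polynomials $\operatorname{gcrd}(a_i,X^n-1)$ exist, and there is an invertible matrix $S'$ such that $S'M\overline T$ is a Smith normal form of $M$ with main diagonal entries $$h_i=\operatorname{gcrd}(a_i,X^n-1)\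 \ (1\le i\le\kappa),\qquad h_i=X^n-1\ \ (\kappa<i\le r\ell).$$ -/

import Mathlib

noncomputable section

namespace SkewQC

/-! ### Skew polynomials twisted by the Frobenius `σ(x) = x ^ q`, `q = |F|` -/

/-- The field `K`, seen as carrying the action of the `q`-Frobenius, where `q = |F|`. -/
def Twisted (_F K : Type*) : Type _ := K

instance (F K : Type*) [Field K] : Field (Twisted F K) := inferInstanceAs (Field K)

/-- The Frobenius `σ : x ↦ x ^ |F|` of `K`. -/
def frob (F K : Type*) [Field F] [Fintype F] [Field K] [Algebra F K] :
    Twisted F K →+* Twisted F K :=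
  (FiniteField.frobeniusAlgHom F K : K →+* K)

theorem frob_apply (F K : Type*) [Field F] [Fintype F] [Field K] [Algebra F K]
    (x : Twisted F K) : frob F K x = x ^ Fintype.card F := rfl

/-- The monoid `ℕ` acts on `K` through the powers of the Frobenius `σ`. -/
instance (F K : Type*) [Field F] [Fintype F] [Field K] [Algebra F K] :
    MulSemiringAction (Multiplicative ℕ) (Twisted F K) :=
  MulSemiringAction.compHom (Twisted F K)
    (powersHom (Twisted F K →+* Twisted F K) (frob F K))

theorem smul_eq (F K : Type*) [Field F] [Fintype F] [Field K] [Algebra F K]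
    (i : Multiplicative ℕ) (x : Twisted F K) :
    i • x = x ^ (Fintype.card F ^ i.toAdd) := by
  change ((frob F K) ^ i.toAdd) x = _
  rw [RingHom.coe_pow, show ⇑(frob F K) = (· ^ Fintype.card F) from rfl, pow_iterate]

/-- The skew polynomial ring `K[X;σ]`, with `X * c = c ^ |F| * X`. -/
abbrev SkewPoly (F K : Type*) [Field K] : Type _ := SkewPolynomial (Twisted F K)

/-- The skew polynomial `X ^ n - 1` of `K[X;σ]`. -/
def modulus (F K : Type*) [Field F] [Fintype F] [Field K] [Algebra F K] (n : ℕ) : SkewPoly F K :=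
  SkewPolynomial.X ^ n - 1

theorem X_mul_C (F K : Type*) [Field F] [Fintype F] [Field K] [Algebra F K] (c : Twisted F K) :
    (SkewPolynomial.X : SkewPoly F K) * SkewPolynomial.C c =
      SkewPolynomial.C (c ^ Fintype.card F) * SkewPolynomial.X := by
  have h : SkewPolynomial.φ c = c ^ Fintype.card F := by
    change (Multiplicative.ofAdd 1 : Multiplicative ℕ) • c = _
    rw [smul_eq]; simp
  rw [← SkewPolynomial.monomial_zero_left, ← SkewPolynomial.monomial_zero_left,
    SkewPolynomial.X_mul_monomial, SkewPolynomial.monomial_mul_X, h]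

/-- The embedding of the coefficient field `K` into `L`. -/
def fieldMap (F K L : Type*) [Field K] [Field L] [Algebra K L] : Twisted F K →+* Twisted F L :=
  algebraMap K L

/-- The inclusion `K[X;σ] → L[X;σ]` for a field extension `L / K`. -/
def inclusion (F K L : Type*) [Field F] [Fintype F] [Field K] [Field L]
    [Algebra F K] [Algebra F L] [Algebra K L] : SkewPoly F K →+* SkewPoly F L :=
  SkewMonoidAlgebra.liftNCRingHom
    ((SkewPolynomial.CRingHom (R := Twisted F L)).comp (fieldMap F K L))
    (powersHom (SkewPoly F L) SkewPolynomial.X) (by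
      intro x y
      simp only [RingHom.comp_apply, powersHom_apply, SkewPolynomial.CRingHom_eq_C, smul_eq,
        map_pow (fieldMap F K L)]
      generalize fieldMap F K L x = z
      induction y.toAdd generalizing z with
      | zero => simp
      | succ i ih =>
        rw [pow_succ (SkewPolynomial.X : SkewPoly F L), mul_assoc (SkewPolynomial.X ^ i), X_mul_C,
          ← mul_assoc, ← mul_assoc, ← ih, pow_succ' (Fintype.card F), pow_mul])

theorem inclusion_X (F K L : Type*) [Field F] [Fintype F] [Field K] [Field L]
    [Algebra F K] [Algebra F L] [Algebra K L] :
    inclusion F K L SkewPolynomial.X = SkewPolynomial.X := by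
  change SkewMonoidAlgebra.liftNC _ _ (SkewMonoidAlgebra.single _ _) = _
  rw [SkewMonoidAlgebra.liftNC_single]
  simp

theorem inclusion_modulus (F K L : Type*) [Field F] [Fintype F] [Field K] [Field L]
    [Algebra F K] [Algebra F L] [Algebra K L] (n : ℕ) :
    inclusion F K L (modulus F K n) = modulus F L n := by
  simp [modulus, inclusion_X]

/-! ### The quotient rings `K[X;σ] / (X ^ n - 1)` and the codes -/

/-- The ideal `(X ^ n - 1)` of `K[X;σ]`. -/
def modulusIdeal (F K : Type*) [Field F] [Fintype F] [Field K] [Algebra F K] (n : ℕ) :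
    Ideal (SkewPoly F K) :=
  (TwoSidedIdeal.span {modulus F K n}).asIdeal

instance (F K : Type*) [Field F] [Fintype F] [Field K] [Algebra F K] (n : ℕ) :
    (modulusIdeal F K n).IsTwoSided :=
  inferInstanceAs (TwoSidedIdeal.span {modulus F K n}).asIdeal.IsTwoSided

/-- The quotient ring `K[X;σ] / (X ^ n - 1)`; it is `P_n` for `K = 𝔽_{q^a}`, and `R_n` for the
field `𝔽_{q^m}`. -/
def QuotRing (F K : Type*) [Field F] [Fintype F] [Field K] [Algebra F K] (n : ℕ) : Type _ :=
  SkewPoly F K ⧸ modulusIdeal F K n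

instance (F K : Type*) [Field F] [Fintype F] [Field K] [Algebra F K] (n : ℕ) :
    Ring (QuotRing F K n) :=
  inferInstanceAs (Ring (SkewPoly F K ⧸ modulusIdeal F K n))

/-- The quotient homomorphism `K[X;σ] → K[X;σ] / (X ^ n - 1)`. -/
def toQuot (F K : Type*) [Field F] [Fintype F] [Field K] [Algebra F K] (n : ℕ) :
    SkewPoly F K →+* QuotRing F K n :=
  Ideal.Quotient.mk (modulusIdeal F K n)

theorem modulusIdeal_le (F K L : Type*) [Field F] [Fintype F] [Field K] [Field L]
    [Algebra F K] [Algebra F L] [Algebra K L] (n : ℕ) :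
    modulusIdeal F K n ≤ (modulusIdeal F L n).comap (inclusion F K L) := by
  have h : TwoSidedIdeal.span {modulus F K n} ≤
      (TwoSidedIdeal.span {modulus F L n}).comap (inclusion F K L) := by
    rw [TwoSidedIdeal.span_le]
    rintro x rfl
    simp only [SetLike.mem_coe, TwoSidedIdeal.mem_comap, inclusion_modulus]
    exact TwoSidedIdeal.subset_span rfl
  intro x hx
  exact (TwoSidedIdeal.mem_comap (inclusion F K L)).1 (h hx)

/-- The ring homomorphism `P_n → R_n` induced by `K[X;σ] → L[X;σ]`. -/
def quotInclusion (F K L : Type*) [Field F] [Fintype F] [Field K] [Field L]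
    [Algebra F K] [Algebra F L] [Algebra K L] (n : ℕ) : QuotRing F K n →+* QuotRing F L n :=
  Ideal.quotientMap (modulusIdeal F L n) (inclusion F K L) (modulusIdeal_le F K L n)

/-- `R_n` is a left module over `P_n`. -/
instance (F K L : Type*) [Field F] [Fintype F] [Field K] [Field L]
    [Algebra F K] [Algebra F L] [Algebra K L] (n : ℕ) :
    Module (QuotRing F K n) (QuotRing F L n) :=
  Module.compHom (QuotRing F L n) (quotInclusion F K L n)

/-- The canonical projection `π : L[X;σ]^ℓ → R_n^ℓ`. -/
def proj (F L : Type*) [Field F] [Fintype F] [Field L] [Algebra F L] (n : ℕ) {ℓ : ℕ}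
    (v : Fin ℓ → SkewPoly F L) : Fin ℓ → QuotRing F L n :=
  fun ι => toQuot F L n (v ι)

/-- The vector of `L[X;σ]^ℓ` with coordinates `x ∈ K[X;σ]^{ℓ r}` under the decomposition
`L[X;σ] = ⨁ j, K[X;σ] b_j`: its `ι`-th entry is `∑ j, x_{ι r + j} b_j` (all indices from `0`). -/
def ofCoords (F : Type*) {K L : Type*} [Field F] [Fintype F] [Field K] [Field L]
    [Algebra F K] [Algebra F L] [Algebra K L] {ℓ r : ℕ} (b : Fin r → L)
    (x : Fin (ℓ * r) → SkewPoly F K) : Fin ℓ → SkewPoly F L :=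
  fun ι => ∑ j : Fin r, inclusion F K L (x (finProdFinEquiv (ι, j))) *
    SkewPolynomial.C (R := Twisted F L) (b j)

/-- The rows of `A`, which are the coordinate vectors of `r̄_1, …, r̄_k ∈ L[X;σ]^ℓ`, generate the
code `C ≤ R_n^ℓ` as a `P_n`-module. -/
def IsGeneratorMatrix {F K L : Type*} [Field F] [Fintype F] [Field K] [Field L]
    [Algebra F K] [Algebra F L] [Algebra K L] {n ℓ r k : ℕ} (b : Fin r → L)
    (C : Submodule (QuotRing F K n) (Fin ℓ → QuotRing F L n))
    (A : Matrix (Fin k) (Fin (ℓ * r)) (SkewPoly F K)) : Prop :=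
  Submodule.span (QuotRing F K n) (Set.range fun i => proj F L n (ofCoords F b (A i))) = C

/-- The matrix with the rows of `A` on top and the rows of `c • Id` below. -/
def stack {R : Type*} [Semiring R] {k N : ℕ} (A : Matrix (Fin k) (Fin N) R) (c : R) :
    Matrix (Fin (k + N)) (Fin N) R :=
  Matrix.of (Fin.append A (Matrix.diagonal fun _ => c))

/-! ### Divisibility and Smith normal forms over a noncommutative ring -/

/-- `s` is a left divisor of `t`. -/
def LeftDvd {R : Type*} [Semiring R] (s t : R) : Prop := ∃ u, t = s * u

/-- `s` is a right divisor of `t`. -/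
def RightDvd {R : Type*} [Semiring R] (s t : R) : Prop := ∃ u, t = u * s

/-- `s` is a total divisor of `t`. -/
def TotalDvd {R : Type*} [Semiring R] (s t : R) : Prop :=
  ∀ u : R, LeftDvd s (u * t) ∧ RightDvd s (t * u)

/-- A skew polynomial with leading coefficient `1`. -/
def IsMonic {R : Type*} [Semiring R] (p : SkewPolynomial R) : Prop :=
  ∃ d, p.coeff d = 1 ∧ ∀ j, d < j → p.coeff j = 0

/-- `d` is the monic greatest common right divisor of `f` and `g`. -/
structure IsGcrd {R : Type*} [Semiring R] [MulSemiringAction (Multiplicative ℕ) R]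
    (d f g : SkewPolynomial R) : Prop where
  monic : IsMonic d
  dvd_left : RightDvd d f
  dvd_right : RightDvd d g
  greatest : ∀ h, RightDvd h f → RightDvd h g → RightDvd h d

/-- The `s × t` matrix `diag(e_1, …, e_ρ, 0, …, 0)`. -/
def rectDiag {R : Type*} [Zero R] (s t : ℕ) {ρ : ℕ} (e : Fin ρ → R) :
    Matrix (Fin s) (Fin t) R :=
  Matrix.of fun i j => if h : i.val = j.val ∧ i.val < ρ then e ⟨i.val, h.2⟩ else 0

/-- The invertible matrices `S` and `T` transform `A` into a Smith normal form
`S A T = diag(e_1, …, e_ρ, 0, …, 0)`, with nonzero `e_i` such that each `e_i` is a total divisor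
of `e_{i+1}`. -/
structure IsSmithNormalForm {R : Type*} [Semiring R] {s t ρ : ℕ} (A : Matrix (Fin s) (Fin t) R)
    (S : Matrix (Fin s) (Fin s) R) (T : Matrix (Fin t) (Fin t) R) (e : Fin ρ → R) : Prop where
  isUnit_left : IsUnit S
  isUnit_right : IsUnit T
  le_rows : ρ ≤ s
  le_cols : ρ ≤ t
  eq_diag : S * A * T = rectDiag s t e
  ne_zero : ∀ i, e i ≠ 0
  totalDvd : ∀ i j : Fin ρ, i.val + 1 = j.val → TotalDvd (e i) (e j)

end SkewQC

end

/-! As `[K : F]` divides `n`, the `n`-th power of `σ` fixes `K`, so `z = X ^ n - 1` is central in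
the domain `R = K[X;σ]`. Hence `d * h = z` forces `h * d = z`, and such an `h` is a total divisor of
`z`.

Part 1: the lower block of the stacked matrix is `z • Id`, and `T⁻¹ (z • Id) T = z • Id`. So a Smith
normal form has a left multiple equal to `z • Id`; its diagonal gives full rank and `h i ∣ z`
(`rank_eq_and_exists_mul_eq`).

Part 2: the same identity turns the stacked matrix into `diag(a)` above `z • Id`. On each pair of
rows an invertible Euclidean matrix replaces `(a i, z)` by `(gcrd, 0)` (`exists_isGcrd`,
`exists_isUnit_stack`). It remains to see that the gcrds form a chain of total divisors. Bézout
gives the right-hand half. The left-hand half follows from it because `K` is finite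
(`totalDvd_of_rightDvd`): a counting argument shows that the largest two-sided ideal inside `R h` is
`R c = c R`, and then `c ∈ h R`. -/

noncomputable section

namespace SkewQC

open Multiplicative

/-! ### Skew polynomials over a finite field: degree, division, total divisors -/

section Size

variable {D : Type*} [Field D]

/-- The size of a skew polynomial: `0` for the zero polynomial, the degree plus one otherwise. -/
def size (p : SkewPolynomial D) : ℕ := p.support.sup (· + 1)

theorem size_le_iff {p : SkewPolynomial D} {m : ℕ} :
    size p ≤ m ↔ ∀ i, m ≤ i → p.coeff i = 0 := by
  simp only [size, Finset.sup_le_iff, SkewPolynomial.mem_support_iff, Nat.succ_le_iff]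
  exact forall_congr' fun i => by rw [← not_lt, not_imp_comm]

theorem coeff_eq_zero_of_size_le {p : SkewPolynomial D} {i : ℕ} (h : size p ≤ i) :
    p.coeff i = 0 :=
  size_le_iff.1 le_rfl i h

theorem size_zero : size (0 : SkewPolynomial D) = 0 := by
  simp [size]

theorem coeff_ne_zero_of_size_eq {p : SkewPolynomial D} {m : ℕ} (h : size p = m + 1) :
    p.coeff m ≠ 0 := by
  intro h0
  have : size p ≤ m := size_le_iff.2 fun i hi => by
    rcases hi.eq_or_lt with rfl | hi
    · exact h0
    · exact coeff_eq_zero_of_size_le (by omega)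
  omega

theorem exists_size_eq {p : SkewPolynomial D} (hp : p ≠ 0) : ∃ m, size p = m + 1 := by
  refine Nat.exists_eq_succ_of_ne_zero fun h => hp ?_
  ext i
  exact coeff_eq_zero_of_size_le (by omega)

theorem size_eq_of_coeff {p : SkewPolynomial D} {m : ℕ} (h : p.coeff m ≠ 0)
    (h' : ∀ i, m < i → p.coeff i = 0) : size p = m + 1 := by
  refine le_antisymm (size_le_iff.2 fun i hi => h' i hi) ?_
  by_contra hlt
  exact h (coeff_eq_zero_of_size_le (by omega))

theorem coeff_sub (f g : SkewPolynomial D) (i : ℕ) :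
    (f - g).coeff i = f.coeff i - g.coeff i := by
  rw [eq_sub_iff_add_eq, ← SkewPolynomial.coeff_add, sub_add_cancel]

/-- Makes the pigeonhole argument in `exists_mul_eq_of_normal` possible. -/
theorem finite_size_le [Finite D] (N : ℕ) : Finite {p : SkewPolynomial D // size p ≤ N} := by
  refine Finite.of_injective (fun p (i : Fin N) => p.1.coeff i) fun p p' h => ?_
  refine Subtype.ext (SkewPolynomial.ext fun i => ?_)
  rcases lt_or_ge i N with hi | hi
  · exact congrFun h ⟨i, hi⟩
  · rw [coeff_eq_zero_of_size_le (p.2.trans hi), coeff_eq_zero_of_size_le (p'.2.trans hi)]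

variable [MulSemiringAction (Multiplicative ℕ) D]

theorem coeff_mul (f g : SkewPolynomial D) (m : ℕ) :
    (f * g).coeff m =
      ∑ p ∈ Finset.HasAntidiagonal.antidiagonal m, f.coeff p.1 * SkewPolynomial.φ^[p.1] (g.coeff p.2) := by
  have := SkewMonoidAlgebra.coeff_mul_antidiagonal_of_finset f g (ofAdd m)
    ((Finset.HasAntidiagonal.antidiagonal m).map
      (ofAdd.toEmbedding.prodMap ofAdd.toEmbedding)) (by
        rintro ⟨a, b⟩
        simp only [Finset.mem_map, Finset.HasAntidiagonal.mem_antidiagonal, Prod.exists]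
        constructor
        · rintro ⟨i, j, rfl, h⟩
          cases h; rfl
        · intro h
          exact ⟨a.toAdd, b.toAdd, h, rfl⟩)
  rw [Finset.sum_map] at this
  simp only [SkewPolynomial.φ_iterate_apply]
  exact this

/-- Every other term of the convolution has an index beyond one of the two size bounds. With exact
sizes this is the leading coefficient of the product, twisted by `φ^[m]`. -/
theorem coeff_mul_of_size {f g : SkewPolynomial D} {m k : ℕ} (hf : size f ≤ m + 1)
    (hg : size g ≤ k + 1) :
    (f * g).coeff (m + k) = f.coeff m * SkewPolynomial.φ^[m] (g.coeff k) := by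
  rw [coeff_mul, Finset.sum_eq_single (m, k)]
  · rintro ⟨i, j⟩ hij hne
    rw [Finset.HasAntidiagonal.mem_antidiagonal] at hij
    simp only at hij ⊢
    rcases lt_trichotomy i m with h | rfl | h
    · rw [coeff_eq_zero_of_size_le (p := g) (by omega), SkewPolynomial.φ_iterate_apply, smul_zero,
        mul_zero]
    · exact absurd (by rw [Nat.add_left_cancel hij]) hne
    · rw [coeff_eq_zero_of_size_le (p := f) (by omega), zero_mul]
  · simp

theorem phi_iterate_ne_zero {c : D} (hc : c ≠ 0) (m : ℕ) : SkewPolynomial.φ^[m] c ≠ 0 := by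
  have h : Function.Injective (SkewPolynomial.φ^[m] : D → D) :=
    (RingHom.injective (SkewPolynomial.φ (R := D))).iterate m
  intro h0
  exact hc (h (h0.trans (by rw [SkewPolynomial.φ_iterate_apply, smul_zero])))

theorem size_mul {f g : SkewPolynomial D} {m k : ℕ} (hf : size f = m + 1) (hg : size g = k + 1) :
    size (f * g) = m + k + 1 := by
  refine size_eq_of_coeff ?_ fun i hi => ?_
  · rw [coeff_mul_of_size hf.le hg.le]
    exact mul_ne_zero (coeff_ne_zero_of_size_eq hf)
      (phi_iterate_ne_zero (coeff_ne_zero_of_size_eq hg) m)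
  · obtain ⟨j, rfl⟩ := Nat.exists_eq_add_of_lt hi
    rw [show m + k + j + 1 = (m + j + 1) + k by ring, coeff_mul_of_size (by omega) hg.le,
      coeff_eq_zero_of_size_le (p := f) (by omega), zero_mul]

instance : NoZeroDivisors (SkewPolynomial D) where
  eq_zero_or_eq_zero_of_mul_eq_zero {f g} h := by
    by_contra! hne
    obtain ⟨m, hm⟩ := exists_size_eq hne.1
    obtain ⟨k, hk⟩ := exists_size_eq hne.2
    have := size_mul hm hk
    rw [h, size_zero] at this
    omega

instance : Nontrivial (SkewPolynomial D) :=
  (SkewPolynomial.C_injective (R := D)).nontrivial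

instance : IsDomain (SkewPolynomial D) := NoZeroDivisors.to_isDomain _

/-- Right division with remainder. -/
theorem exists_size_sub_mul_lt {g : SkewPolynomial D} (hg : g ≠ 0) (f : SkewPolynomial D) :
    ∃ q, size (f - q * g) < size g := by
  induction hs : size f using Nat.strong_induction_on generalizing f with
  | _ s ih =>
    subst hs
    rcases lt_or_ge (size f) (size g) with h | h
    · exact ⟨0, by rwa [zero_mul, sub_zero]⟩
    obtain ⟨k, hk⟩ := exists_size_eq hg
    obtain ⟨m, hm⟩ : ∃ m, size f = m + k + 1 := ⟨size f - (k + 1), by omega⟩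
    -- Dividing by the twisted leading coefficient of `g` makes the leading terms of `f` and
    -- `monomial m c * g` cancel.
    set c : D := f.coeff (m + k) / SkewPolynomial.φ^[m] (g.coeff k) with hc
    have hc0 : c ≠ 0 := div_ne_zero (coeff_ne_zero_of_size_eq hm)
      (phi_iterate_ne_zero (coeff_ne_zero_of_size_eq hk) m)
    have hmono : size (SkewPolynomial.monomial m c) = m + 1 := by
      refine size_eq_of_coeff (by rwa [SkewPolynomial.coeff_monomial, if_pos rfl]) fun i hi => ?_
      rw [SkewPolynomial.coeff_monomial, if_neg hi.ne]
    have hlt : size (f - SkewPolynomial.monomial m c * g) < size f := by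
      rw [hm, Nat.lt_succ_iff, size_le_iff]
      intro i hi
      rw [coeff_sub]
      rcases hi.eq_or_lt with rfl | hi
      · rw [coeff_mul_of_size hmono.le hk.le, SkewPolynomial.coeff_monomial, if_pos rfl, hc,
          div_mul_cancel₀ _ (phi_iterate_ne_zero (coeff_ne_zero_of_size_eq hk) m), sub_self]
      · rw [coeff_eq_zero_of_size_le (p := f) (by omega),
          coeff_eq_zero_of_size_le (by rw [size_mul hmono hk]; omega), sub_zero]
    obtain ⟨q, hq⟩ := ih _ hlt _ rfl
    exact ⟨q + SkewPolynomial.monomial m c, by rwa [add_mul, add_comm, ← sub_sub]⟩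

open Matrix in
/-- The Euclidean algorithm, as an invertible matrix. -/
theorem exists_isUnit_mulVec (f g : SkewPolynomial D) :
    ∃ (U : Matrix (Fin 2) (Fin 2) (SkewPolynomial D)) (d : SkewPolynomial D),
      IsUnit U ∧ U *ᵥ ![f, g] = ![d, 0] := by
  induction hs : size f using Nat.strong_induction_on generalizing f g with
  | _ s ih =>
    subst hs
    -- One Euclidean step: subtract `q` times the first entry from the second, then swap.
    have key (q : SkewPolynomial D) : IsUnit !![-q, 1; 1, 0] :=
      ⟨⟨!![-q, 1; 1, 0], !![0, 1; 1, q], by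
        simp [Matrix.one_fin_two], by simp [Matrix.one_fin_two]⟩, rfl⟩
    rcases eq_or_ne f 0 with rfl | hf
    · exact ⟨!![-0, 1; 1, 0], g, key 0, by simp⟩
    · obtain ⟨q, hq⟩ := exists_size_sub_mul_lt hf g
      obtain ⟨U, d, hU, h⟩ := ih _ hq (g - q * f) f rfl
      refine ⟨U * !![-q, 1; 1, 0], d, hU.mul (key q), ?_⟩
      rw [← mulVec_mulVec, ← h]
      congr 1
      simp [sub_eq_neg_add]

open Matrix in
/-- The monic greatest common right divisor, with an invertible Bézout matrix. -/
theorem exists_isGcrd (f : SkewPolynomial D) {g : SkewPolynomial D} (hg : g ≠ 0) :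
    ∃ (U : Matrix (Fin 2) (Fin 2) (SkewPolynomial D)) (d : SkewPolynomial D),
      IsUnit U ∧ U *ᵥ ![f, g] = ![d, 0] ∧ IsGcrd d f g := by
  obtain ⟨U, d, hU, h⟩ := exists_isUnit_mulVec f g
  -- An invertible matrix kills no nonzero vector, and `g ≠ 0`.
  have hd : d ≠ 0 := by
    rintro rfl
    have h0 : U *ᵥ ![f, g] = 0 := by rw [h]; ext i; fin_cases i <;> rfl
    obtain ⟨V, rfl⟩ := hU
    have h1 := congrArg ((↑V⁻¹ : Matrix (Fin 2) (Fin 2) (SkewPolynomial D)) *ᵥ ·) h0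
    simp only [mulVec_mulVec, Units.inv_mul, one_mulVec, mulVec_zero] at h1
    exact hg (congrFun h1 1)
  obtain ⟨m, hm⟩ := exists_size_eq hd
  have hc := coeff_ne_zero_of_size_eq hm
  set c := d.coeff m with hcdef
  have hcc (x y : D) (hxy : x * y = 1) :
      !![SkewPolynomial.C x, 0; 0, 1] * !![SkewPolynomial.C y, 0; 0, 1] = 1 := by
    simp [Matrix.one_fin_two, ← SkewPolynomial.C_mul, hxy, SkewPolynomial.C_1]
  -- Rescaling the first row by `c⁻¹` makes the gcrd monic and keeps the matrix invertible.
  have hW : IsUnit !![SkewPolynomial.C c⁻¹, 0; 0, 1] :=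
    ⟨⟨_, !![SkewPolynomial.C c, 0; 0, 1], hcc _ _ (inv_mul_cancel₀ hc),
      hcc _ _ (mul_inv_cancel₀ hc)⟩, rfl⟩
  have hW' : (!![SkewPolynomial.C c⁻¹, 0; 0, 1] * U) *ᵥ ![f, g] =
      ![SkewPolynomial.C c⁻¹ * d, 0] := by
    rw [← mulVec_mulVec, h]; simp
  have hCsize : size (SkewPolynomial.C c⁻¹) = 0 + 1 :=
    size_eq_of_coeff (by simpa using hc) fun i hi => SkewPolynomial.coeff_C_ne_zero hi.ne'
  refine ⟨_, _, hW.mul hU, hW', ⟨m, ?_, fun j hj => ?_⟩, ?_, ?_, ?_⟩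
  · have := coeff_mul_of_size hCsize.le hm.le
    rw [zero_add] at this
    rw [this, SkewPolynomial.coeff_C_zero, Function.iterate_zero, id, inv_mul_cancel₀ hc]
  · exact coeff_eq_zero_of_size_le (by rw [size_mul hCsize hm]; omega)
  -- The first column of the inverse matrix writes `f` and `g` as left multiples of the gcrd.
  · obtain ⟨V, hV⟩ := hW.mul hU
    rw [← hV] at hW'
    have h1 := congrArg ((↑V⁻¹ : Matrix (Fin 2) (Fin 2) (SkewPolynomial D)) *ᵥ ·) hW'
    simp only [mulVec_mulVec, Units.inv_mul, one_mulVec] at h1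
    exact ⟨(↑V⁻¹ : Matrix (Fin 2) (Fin 2) (SkewPolynomial D)) 0 0, by simpa using congrFun h1 0⟩
  · obtain ⟨V, hV⟩ := hW.mul hU
    rw [← hV] at hW'
    have h1 := congrArg ((↑V⁻¹ : Matrix (Fin 2) (Fin 2) (SkewPolynomial D)) *ᵥ ·) hW'
    simp only [mulVec_mulVec, Units.inv_mul, one_mulVec] at h1
    exact ⟨(↑V⁻¹ : Matrix (Fin 2) (Fin 2) (SkewPolynomial D)) 1 0, by simpa using congrFun h1 1⟩
  -- The first row of the matrix is a Bézout relation.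
  · rintro e ⟨x, rfl⟩ ⟨y, rfl⟩
    have h1 := congrFun hW' 0
    simp only [mulVec, dotProduct, Fin.sum_univ_two, cons_val_zero, cons_val_one] at h1
    exact ⟨_, by rw [← h1, ← mul_assoc, ← mul_assoc, ← add_mul]⟩

/-- Over a finite field, if `c R ⊆ R c` then `R c ⊆ c R`. -/
theorem exists_mul_eq_of_normal [Finite D] {c : SkewPolynomial D} (hc : c ≠ 0)
    (h : ∀ u, ∃ w, c * u = w * c) (w : SkewPolynomial D) : ∃ u, c * u = w * c := by
  choose φ hφ using h
  have hsize (u) : size (φ u) = size u := by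
    rcases eq_or_ne u 0 with rfl | hu
    · have : φ 0 = 0 := by simpa [hc, eq_comm] using hφ 0
      rw [this]
    · have hw : φ u ≠ 0 := fun h0 => mul_ne_zero hc hu (by rw [hφ, h0, zero_mul])
      obtain ⟨i, hi⟩ := exists_size_eq hu
      obtain ⟨j, hj⟩ := exists_size_eq hw
      obtain ⟨k, hk⟩ := exists_size_eq hc
      have h1 := size_mul hk hi
      rw [hφ, size_mul hj hk] at h1
      omega
  have := finite_size_le (D := D) (size w)
  let ψ (p : {p : SkewPolynomial D // size p ≤ size w}) : {p : SkewPolynomial D // size p ≤ size w} :=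
    ⟨φ p.1, (hsize p.1).trans_le p.2⟩
  -- `φ` preserves size, so it restricts to an injective self-map of a finite set, which is
  -- surjective.
  have hψ : Function.Injective ψ := fun p p' hp => Subtype.ext <| mul_left_cancel₀ hc <| by
    rw [hφ, hφ, show φ p.1 = φ p'.1 from congrArg Subtype.val hp]
  obtain ⟨u, hu⟩ := Finite.surjective_of_injective hψ ⟨w, le_rfl⟩
  exact ⟨u.1, by rw [hφ, show φ u.1 = w from congrArg Subtype.val hu]⟩

/-- Over a finite field, `w R ⊆ R h` suffices for `h` to be a total divisor of `w`. -/
theorem totalDvd_of_rightDvd [Finite D] {h w : SkewPolynomial D}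
    (hw : ∀ u, RightDvd h (w * u)) : TotalDvd h w := by
  suffices key : ∀ v, (∀ u, RightDvd h (v * u)) → LeftDvd h v from fun u =>
    ⟨key _ fun x => by
      obtain ⟨y, hy⟩ := hw x
      exact ⟨u * y, by rw [mul_assoc, hy, mul_assoc]⟩, hw u⟩
  intro v hv
  rcases eq_or_ne v 0 with rfl | hv0
  · exact ⟨0, by rw [mul_zero]⟩
  -- The `x` with `x R ⊆ R h` form a two-sided ideal; an element `c` of minimal size generates it as
  -- a left ideal.
  obtain ⟨c, ⟨hc0, hc⟩, hmin⟩ := WellFounded.has_min (measure size).wf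
    {c : SkewPolynomial D | c ≠ 0 ∧ ∀ u, RightDvd h (c * u)} ⟨v, hv0, hv⟩
  have hgen (x : SkewPolynomial D) (hx : ∀ u, RightDvd h (x * u)) : ∃ y, x = y * c := by
    obtain ⟨q, hq⟩ := exists_size_sub_mul_lt hc0 x
    refine ⟨q, sub_eq_zero.1 ?_⟩
    by_contra hne
    refine hmin _ ⟨hne, fun u => ?_⟩ hq
    obtain ⟨y, hy⟩ := hx u
    obtain ⟨y', hy'⟩ := hc u
    exact ⟨y - q * y', by rw [sub_mul, hy, mul_assoc, hy', sub_mul, mul_assoc]⟩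
  have hnormal := exists_mul_eq_of_normal hc0 fun u =>
    hgen (c * u) fun x => by rw [mul_assoc]; exact hc _
  obtain ⟨t, ht⟩ := hc 1
  rw [mul_one] at ht
  have ht0 : t ≠ 0 := by rintro rfl; exact hc0 (by rw [ht, zero_mul])
  -- From `c = t * h` and `c * t' = t * c`, cancelling `t` moves `h` to the left: `c = h * t'`.
  obtain ⟨t', ht'⟩ := hnormal t
  have hct : h * t' = c := mul_left_cancel₀ ht0 (by rw [← mul_assoc, ← ht, ht'])
  obtain ⟨y, rfl⟩ := hgen v hv
  obtain ⟨u, hu⟩ := hnormal y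
  exact ⟨t' * u, by rw [← mul_assoc, hct, hu]⟩

end Size

/-! ### Divisors of a central element -/

section Central

variable {R : Type*} [Ring R]

theorem mul_eq_of_central [IsDomain R] {z h d : R} (hz : ∀ p, Commute z p) (hz0 : z ≠ 0)
    (h1 : d * h = z) : h * d = z := by
  have hh : h ≠ 0 := by rintro rfl; exact hz0 (by rw [← h1, mul_zero])
  -- `h * d * h = h * z = z * h`, and `h` cancels.
  refine mul_right_cancel₀ hh ?_
  rw [mul_assoc, h1, (hz h).eq]

theorem totalDvd_of_central {z h d : R} (hz : ∀ p, Commute z p)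
    (h1 : d * h = z) (h2 : h * d = z) : TotalDvd h z := fun u =>
  ⟨⟨d * u, by rw [← mul_assoc, h2, (hz u).eq]⟩, ⟨u * d, by rw [mul_assoc, h1, (hz u).eq]⟩⟩

end Central

/-! ### Centrality of `X ^ n - 1` -/

section Modulus

variable (F K : Type*) [Field F] [Fintype F] [Field K] [Algebra F K]

instance [Finite K] : Finite (Twisted F K) := inferInstanceAs (Finite K)

theorem commute_modulus [Finite K] {n : ℕ} (hn : Module.finrank F K ∣ n) (p : SkewPoly F K) :
    Commute (modulus F K n) p := by
  refine Commute.sub_left ?_ (Commute.one_left p)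
  -- With `n = [K : F] * e`, the `n`-th Frobenius power is `x ↦ x ^ (|K| ^ e)`, the identity on `K`.
  have hφ (c : Twisted F K) : SkewPolynomial.φ^[n] c = c := by
    rw [SkewPolynomial.φ_iterate_apply, smul_eq, toAdd_ofAdd]
    obtain ⟨e, rfl⟩ := hn
    have := Fintype.ofFinite K
    rw [pow_mul, ← Module.card_eq_pow_finrank (K := F) (V := K)]
    exact FiniteField.pow_card_pow (K := K) e c
  rw [commute_iff_eq, SkewPolynomial.X_pow_mul]
  simp only [hφ]
  rw [SkewPolynomial.sum_monomial]

theorem modulus_ne_zero {n : ℕ} (hn : 0 < n) : modulus F K n ≠ 0 := by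
  intro h
  have h1 := congrArg (fun p => SkewPolynomial.coeff p n) h
  simp only [modulus, coeff_sub, SkewPolynomial.X_pow_eq_monomial, SkewPolynomial.coeff_monomial,
    SkewPolynomial.coeff_one, if_neg hn.ne, SkewPolynomial.coeff_zero] at h1
  simp at h1

end Modulus

/-! ### Matrices -/

section Matrices

open Matrix

variable {R : Type*}

theorem isUnit_submatrix [Semiring R] {m n : Type*} [Fintype m] [DecidableEq m] [Fintype n]
    [DecidableEq n] {M : Matrix m m R} (hM : IsUnit M) (e f : n ≃ m) :
    IsUnit (M.submatrix e f) := by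
  obtain ⟨U, rfl⟩ := hM
  refine isUnit_iff_exists.2 ⟨(↑U⁻¹ : Matrix m m R).submatrix f e, ?_, ?_⟩
  · rw [submatrix_mul_equiv, Units.mul_inv, submatrix_one_equiv]
  · rw [submatrix_mul_equiv, Units.inv_mul, submatrix_one_equiv]

theorem isUnit_fromBlocks_diagonal [Semiring R] {m n : Type*} [Fintype m] [DecidableEq m]
    [Fintype n] [DecidableEq n] {M : Matrix m m R} {N : Matrix n n R}
    (hM : IsUnit M) (hN : IsUnit N) : IsUnit (fromBlocks M 0 0 N) := by
  obtain ⟨U, rfl⟩ := hM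
  obtain ⟨V, rfl⟩ := hN
  refine isUnit_iff_exists.2
    ⟨fromBlocks (↑U⁻¹ : Matrix m m R) 0 0 (↑V⁻¹ : Matrix n n R), ?_, ?_⟩ <;>
    simp [fromBlocks_multiply]

theorem isUnit_blockDiagonal [Semiring R] {m o : Type*} [Fintype m] [DecidableEq m]
    [Fintype o] [DecidableEq o] {U : o → Matrix m m R} (hU : ∀ i, IsUnit (U i)) :
    IsUnit (blockDiagonal U) := by
  choose V hV using hU
  refine isUnit_iff_exists.2 ⟨blockDiagonal fun i => (↑(V i)⁻¹ : Matrix m m R), ?_, ?_⟩ <;>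
    rw [← blockDiagonal_mul] <;> simp only [← hV, Units.mul_inv, Units.inv_mul] <;>
    exact blockDiagonal_one

/-- Simultaneous invertible row operations on disjoint sets of rows. -/
theorem exists_isUnit_rows [Semiring R] {m o ι κ : Type*} [Fintype m] [DecidableEq m]
    [Fintype o] [DecidableEq o] [Fintype ι] [DecidableEq ι] (ε : m × o → ι)
    (hε : Function.Injective ε) {U : o → Matrix m m R} (hU : ∀ i, IsUnit (U i))
    (B : Matrix ι κ R) :
    ∃ G : Matrix ι ι R, IsUnit G ∧
      (∀ s i j, (G * B) (ε (s, i)) j = ∑ t, U i s t * B (ε (t, i)) j) ∧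
      ∀ x ∉ Set.range ε, ∀ j, (G * B) x j = B x j := by
  classical
  -- Splits the rows into those moved by some `U i` and the rest, so that `G` is block diagonal up
  -- to reindexing.
  let e : (m × o) ⊕ ((Set.range ε)ᶜ : Set ι) ≃ ι :=
    (Equiv.sumCongr (Equiv.ofInjective ε hε) (Equiv.refl _)).trans (Equiv.Set.sumCompl _)
  have hl (p) : e (Sum.inl p) = ε p := rfl
  have hr (x) : e (Sum.inr x) = x.1 := rfl
  have hG (x j) : ((fromBlocks (blockDiagonal U) 0 0 1).submatrix e.symm e.symm * B) (e x) j =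
      (fromBlocks (blockDiagonal U) 0 0 (1 : Matrix ((Set.range ε)ᶜ : Set ι)
          ((Set.range ε)ᶜ : Set ι) R) *
        fromRows (B.submatrix (e ∘ Sum.inl) id) (B.submatrix (e ∘ Sum.inr) id) :
          Matrix _ κ R) x j := by
    have : B = (fromRows (B.submatrix (e ∘ Sum.inl) id)
        (B.submatrix (e ∘ Sum.inr) id)).submatrix e.symm id := by
      ext y j
      obtain ⟨y | y, rfl⟩ := e.surjective y <;> simp
    conv_lhs => rw [this]
    rw [submatrix_mul_equiv, submatrix_apply, Equiv.symm_apply_apply, id]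
  refine ⟨_, isUnit_submatrix (isUnit_fromBlocks_diagonal (isUnit_blockDiagonal hU) isUnit_one)
    e.symm e.symm, fun s i j => ?_, fun x hx j => ?_⟩
  · rw [← hl, hG, fromBlocks_mul_fromRows, fromRows_apply_inl]
    simp [mul_apply, Fintype.sum_prod_type, blockDiagonal_apply, hl]
  · have h := hG (Sum.inr ⟨x, hx⟩) j
    rw [fromBlocks_mul_fromRows, fromRows_apply_inr] at h
    simpa [hr] using h

theorem stack_eq [Semiring R] {k N : ℕ} (A : Matrix (Fin k) (Fin N) R) (z : R) :
    stack A z = (fromRows A (diagonal fun _ => z)).submatrix finSumFinEquiv.symm id := by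
  ext x j
  obtain ⟨x | x, rfl⟩ := finSumFinEquiv.surjective x
  · simpa [stack] using congrFun (Fin.append_left A _ x) j
  · simpa [stack] using congrFun (Fin.append_right A _ x) j

theorem diagonal_mul_comm_of_central [Semiring R] {N : ℕ} {z : R} (hz : ∀ p, Commute z p)
    (T : Matrix (Fin N) (Fin N) R) : diagonal (fun _ => z) * T = T * diagonal fun _ => z := by
  ext i j
  rw [diagonal_mul, mul_diagonal, (hz _).eq]

/-- A Smith normal form of the stacked matrix has full rank and its entries are right divisors
of the central element. -/
theorem rank_eq_and_exists_mul_eq [Ring R] {k N ρ : ℕ} {A : Matrix (Fin k) (Fin N) R} {z : R}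
    (hz : ∀ p, Commute z p) (hz0 : z ≠ 0) {S : Matrix (Fin (k + N)) (Fin (k + N)) R}
    {T : Matrix (Fin N) (Fin N) R} {h : Fin ρ → R} (H : IsSmithNormalForm (stack A z) S T h) :
    ρ = N ∧ ∀ i, ∃ d, d * h i = z := by
  obtain ⟨S, rfl⟩ := H.isUnit_left
  obtain ⟨T, rfl⟩ := H.isUnit_right
  -- `P` selects the lower block of the stacked matrix.
  let P : Matrix (Fin N) (Fin (k + N)) R :=
    (fromCols (0 : Matrix (Fin N) (Fin k) R) 1).submatrix id finSumFinEquiv.symm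
  have hP : P * stack A z = diagonal fun _ => z := by
    rw [stack_eq, submatrix_mul_equiv, fromCols_mul_fromRows]
    simp
  have hQ : ((↑T⁻¹ : Matrix (Fin N) (Fin N) R) * P * (↑S⁻¹ : Matrix (Fin (k + N)) (Fin (k + N)) R)) *
      rectDiag (k + N) N h = diagonal fun _ => z := by
    rw [← H.eq_diag]
    calc _ = (↑T⁻¹ : Matrix (Fin N) (Fin N) R) *
          (P * (((↑S⁻¹ : Matrix (Fin (k + N)) (Fin (k + N)) R) *
            (S : Matrix (Fin (k + N)) (Fin (k + N)) R)) * stack A z)) *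
            (T : Matrix (Fin N) (Fin N) R) := by
            simp only [Matrix.mul_assoc]
      _ = _ := by
        rw [Units.inv_mul, Matrix.one_mul, hP, ← diagonal_mul_comm_of_central hz,
          Matrix.mul_assoc, Units.inv_mul, Matrix.mul_one]
  generalize (↑T⁻¹ : Matrix (Fin N) (Fin N) R) * P * (↑S⁻¹ : Matrix (Fin (k + N)) (Fin (k + N)) R) = Q at hQ
  -- A diagonal entry at `i ≥ ρ` would be zero on the left but `z ≠ 0` on the right, so the rank is
  -- full.
  have hent (i : Fin N) : ∃ hi : i.val < ρ, Q i (i.castLE (by omega)) * h ⟨i, hi⟩ = z := by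
    have h1 := congrFun (congrFun hQ i) i
    rw [diagonal_apply_eq, mul_apply, Finset.sum_eq_single (i.castLE (by omega))] at h1
    · rcases lt_or_ge i.val ρ with hi | hi
      · exact ⟨hi, by simpa [rectDiag, hi] using h1⟩
      · exact absurd (by simpa [rectDiag, hi.not_gt] using h1.symm) hz0
    · intro x _ hx
      rw [rectDiag, of_apply, dif_neg, mul_zero]
      rintro ⟨hxi, -⟩
      exact hx (Fin.ext hxi)
    · simp
  have hρ : ρ = N := by
    refine le_antisymm H.le_cols ?_
    by_contra hlt
    obtain ⟨hi, -⟩ := hent ⟨ρ, by omega⟩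
    exact lt_irrefl _ hi
  exact ⟨hρ, fun i => ⟨_, (hent ⟨i, by omega⟩).2⟩⟩

/-- Row operations which transform the stacked matrix of a matrix in Smith normal form. -/
theorem exists_isUnit_stack [Ring R] {k N κ : ℕ} {A : Matrix (Fin k) (Fin N) R} {z : R}
    (hz : ∀ p, Commute z p) {S : Matrix (Fin k) (Fin k) R}
    {T : Matrix (Fin N) (Fin N) R} {a : Fin κ → R} (H : IsSmithNormalForm A S T a)
    {U : Fin κ → Matrix (Fin 2) (Fin 2) R} (hU : ∀ i, IsUnit (U i)) {g : Fin κ → R}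
    (hg : ∀ i, U i *ᵥ ![a i, z] = ![g i, 0]) :
    ∃ S' : Matrix (Fin (k + N)) (Fin (k + N)) R, IsUnit S' ∧
      S' * stack A z * T = rectDiag (k + N) N
        (fun i : Fin N => if hi : i.val < κ then g ⟨i.val, hi⟩ else z) := by
  have hk := H.le_rows
  have hN := H.le_cols
  obtain ⟨T, rfl⟩ := H.isUnit_right
  set B : Matrix (Fin k ⊕ Fin N) (Fin N) R :=
    fromRows (rectDiag k N a) (diagonal fun _ => z) with hB
  -- Acting by `T⁻¹` on the lower rows undoes the effect of `T` there, since `z • Id` commutes with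
  -- `T`.
  have hBmul : fromBlocks S 0 0 (↑T⁻¹ : Matrix (Fin N) (Fin N) R) *
      fromRows A (diagonal fun _ => z) * (T : Matrix (Fin N) (Fin N) R) = B := by
    rw [fromBlocks_mul_fromRows, fromRows_mul, Matrix.zero_mul, Matrix.zero_mul, add_zero,
      zero_add, H.eq_diag, ← diagonal_mul_comm_of_central hz, Matrix.mul_assoc, Units.inv_mul,
      Matrix.mul_one]
  -- Pairs the rows of `a i` and of the `i`-th `z`, on which `U i` acts.
  let ε (p : Fin 2 × Fin κ) : Fin k ⊕ Fin N :=
    if p.1 = 0 then Sum.inl (p.2.castLE hk) else Sum.inr (p.2.castLE hN)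
  have hε0 (i) : ε (0, i) = Sum.inl (i.castLE hk) := rfl
  have hε1 (i) : ε (1, i) = Sum.inr (i.castLE hN) := rfl
  have hε : Function.Injective ε := by
    rintro ⟨s, i⟩ ⟨t, j⟩ hij
    fin_cases s <;> fin_cases t <;> simp [ε] at hij <;> simp [hij]
  obtain ⟨G, hG, hGin, hGout⟩ := exists_isUnit_rows ε hε hU B
  have hrow (s i j) : (G * B) (ε (s, i)) j =
      if i.val = j.val then (![g i, 0] : Fin 2 → R) s else 0 := by
    rw [hGin, Fin.sum_univ_two, hε0, hε1, hB, fromRows_apply_inl, fromRows_apply_inr, ← hg]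
    by_cases hij : i.val = j.val
    · obtain rfl : i.castLE hN = j := Fin.ext hij
      simp [rectDiag, mulVec, dotProduct]
    · have : i.castLE hN ≠ j := fun h => hij (congrArg Fin.val h)
      simp [rectDiag, hij, this]
  have hinl (i : Fin k) (hi : κ ≤ i.val) (j) : (G * B) (Sum.inl i) j = 0 := by
    rw [hGout]
    · simp [hB, rectDiag, hi.not_gt]
    · rintro ⟨⟨s, i'⟩, h⟩
      fin_cases s <;> simp [ε] at h
      exact hi.not_gt (h ▸ i'.2)
  have hinr (i : Fin N) (hi : κ ≤ i.val) (j) : (G * B) (Sum.inr i) j = if i = j then z else 0 := by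
    rw [hGout]
    · simp [hB, diagonal_apply]
    · rintro ⟨⟨s, i'⟩, h⟩
      fin_cases s <;> simp [ε] at h
      exact hi.not_gt (h ▸ i'.2)
  -- Locates the row holding the `i`-th diagonal entry: the gcrds are in the upper block, the
  -- untouched `z` in the lower one. The permutation `π` moves these rows to the top.
  let f (i : Fin N) : Fin k ⊕ Fin N :=
    if hi : i.val < κ then Sum.inl ⟨i, by omega⟩ else Sum.inr i
  have hf : Function.Injective f := by
    intro i j hij
    simp only [f] at hij
    split_ifs at hij <;> simp_all [Fin.ext_iff]
  obtain ⟨π, hπ⟩ := Equiv.Perm.exists_extending_pair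
    (fun i : Fin N => finSumFinEquiv.symm (i.castLE (Nat.le_add_left N k))) f
    (finSumFinEquiv.symm.injective.comp (Fin.castLE_injective _)) hf
  refine ⟨(G * fromBlocks S 0 0 (↑T⁻¹ : Matrix (Fin N) (Fin N) R)).submatrix
    (finSumFinEquiv.symm.trans π) finSumFinEquiv.symm, isUnit_submatrix
      (hG.mul (isUnit_fromBlocks_diagonal H.isUnit_left T⁻¹.isUnit)) _ _, ?_⟩
  have hT : (T : Matrix (Fin N) (Fin N) R) = (T : Matrix (Fin N) (Fin N) R).submatrix id id := rfl
  rw [stack_eq, submatrix_mul_equiv, hT, submatrix_mul _ _ _ id _ Function.bijective_id |>.symm,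
    Matrix.mul_assoc G, Matrix.mul_assoc G, hBmul]
  ext x j
  rw [submatrix_apply, id, Equiv.trans_apply, rectDiag, of_apply]
  rcases lt_or_ge x.val N with hx | hx
  · have hx' : π (finSumFinEquiv.symm x) = f ⟨x, hx⟩ := hπ ⟨x, hx⟩
    rw [hx']
    by_cases hxκ : x.val < κ
    · have : f ⟨x, hx⟩ = ε (0, ⟨x, hxκ⟩) := by simp [f, hxκ, ε]
      rw [this, hrow]
      simp only [hx, hxκ, and_true, dif_pos]
      split_ifs <;> rfl
    · have : f ⟨x, hx⟩ = Sum.inr ⟨x, hx⟩ := by simp [f, hxκ]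
      rw [this, hinr _ (not_lt.1 hxκ)]
      simp [hx, hxκ, Fin.ext_iff]
  -- The rows missed by `f` are zero: upper rows from `κ` on, and lower rows below `κ`, which the `U
  -- i` cleared.
  · have hout (i : Fin N) : π (finSumFinEquiv.symm x) ≠ f i := by
      rw [← hπ i]
      intro h
      have := finSumFinEquiv.symm.injective (π.injective h)
      have := congrArg Fin.val this
      simp only [Fin.val_castLE] at this
      omega
    rw [dif_neg (fun h => hx.not_gt h.2)]
    rcases hy : π (finSumFinEquiv.symm x) with y | y
    · refine hinl y (not_lt.1 fun hlt => hout ⟨y, by omega⟩ ?_) j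
      simp [hy, f, hlt]
    · rcases lt_or_ge y.val κ with hlt | hge
      · rw [show (Sum.inr y : Fin k ⊕ Fin N) = ε (1, ⟨y, hlt⟩) from rfl, hrow]
        simp
      · exact absurd (by simp [hy, f, hge.not_gt]) (hout y)

end Matrices

end SkewQC

end

theorem mainTheorem2
    {F K L : Type*} [Field F] [Fintype F] [Field K] [Finite K] [Field L] [Finite L]
    [Algebra F K] [Algebra F L] [Algebra K L] [IsScalarTower F K L]
    (n : ℕ) (hn : 0 < n) (hmn : Module.finrank F L ∣ n)
    (ℓ r : ℕ) (b : Module.Basis (Fin r) K L)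
    (C : Submodule (SkewQC.QuotRing F K n) (Fin ℓ → SkewQC.QuotRing F L n))
    (k : ℕ) (A : Matrix (Fin k) (Fin (ℓ * r)) (SkewQC.SkewPoly F K))
    (hA : SkewQC.IsGeneratorMatrix b C A) :
    (∀ (S : Matrix (Fin (k + ℓ * r)) (Fin (k + ℓ * r)) (SkewQC.SkewPoly F K))
        (T : Matrix (Fin (ℓ * r)) (Fin (ℓ * r)) (SkewQC.SkewPoly F K))
        (ρ : ℕ) (h : Fin ρ → SkewQC.SkewPoly F K),
      SkewQC.IsSmithNormalForm (SkewQC.stack A (SkewQC.modulus F K n)) S T h →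
        ρ = ℓ * r ∧
        ∀ i, SkewQC.TotalDvd (h i) (SkewQC.modulus F K n) ∧
          ∃ d, h i * d = SkewQC.modulus F K n ∧ d * h i = SkewQC.modulus F K n) ∧
    (∀ (S : Matrix (Fin k) (Fin k) (SkewQC.SkewPoly F K))
        (T : Matrix (Fin (ℓ * r)) (Fin (ℓ * r)) (SkewQC.SkewPoly F K))
        (κ : ℕ) (a : Fin κ → SkewQC.SkewPoly F K),
      SkewQC.IsSmithNormalForm A S T a →
        ∃ g : Fin κ → SkewQC.SkewPoly F K,
          (∀ i, SkewQC.IsGcrd (g i) (a i) (SkewQC.modulus F K n)) ∧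
          ∃ S' : Matrix (Fin (k + ℓ * r)) (Fin (k + ℓ * r)) (SkewQC.SkewPoly F K),
            SkewQC.IsSmithNormalForm (SkewQC.stack A (SkewQC.modulus F K n)) S' T
              (fun i : Fin (ℓ * r) =>
                if hi : i.val < κ then g ⟨i.val, hi⟩ else SkewQC.modulus F K n)) := by
  have hK : Module.finrank F K ∣ n :=
    (Module.finrank_mul_finrank F K L ▸ dvd_mul_right _ _).trans hmn
  have hz := SkewQC.commute_modulus F K hK
  have hz0 := SkewQC.modulus_ne_zero F K hn
  refine ⟨fun S T ρ h H => ?_, fun S T κ a H => ?_⟩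
  · obtain ⟨hρ, hd⟩ := SkewQC.rank_eq_and_exists_mul_eq hz hz0 H
    refine ⟨hρ, fun i => ?_⟩
    obtain ⟨d, hd⟩ := hd i
    have hd' := SkewQC.mul_eq_of_central hz hz0 hd
    exact ⟨SkewQC.totalDvd_of_central hz hd hd', d, hd', hd⟩
  · choose U g hU hg hgcrd using fun i => SkewQC.exists_isGcrd (a i) hz0
    refine ⟨g, hgcrd, ?_⟩
    obtain ⟨S', hS', hdiag⟩ := SkewQC.exists_isUnit_stack hz H hU hg
    have hself : SkewQC.TotalDvd (SkewQC.modulus F K n) (SkewQC.modulus F K n) :=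
      SkewQC.totalDvd_of_central hz (one_mul _) (mul_one _)
    have hgz (i) : SkewQC.TotalDvd (g i) (SkewQC.modulus F K n) := by
      obtain ⟨d, hd⟩ := (hgcrd i).dvd_right
      exact SkewQC.totalDvd_of_central hz hd.symm (SkewQC.mul_eq_of_central hz hz0 hd.symm)
    -- Both `a j * u` (through `a i`) and `z * u` lie in `R (g i)`, hence so does `g j * u` by
    -- Bézout; `totalDvd_of_rightDvd` supplies the left-hand half.
    have hgg (i j : Fin κ) (hij : i.val + 1 = j.val) : SkewQC.TotalDvd (g i) (g j) := by
      refine SkewQC.totalDvd_of_rightDvd fun u => ?_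
      obtain ⟨x, hx⟩ := (H.totalDvd i j hij u).2
      obtain ⟨y, hy⟩ := (hgcrd i).dvd_left
      obtain ⟨w, hw⟩ := (hgz i u).2
      have h1 := congrFun (hg j) 0
      simp only [Matrix.mulVec, dotProduct, Fin.sum_univ_two, Matrix.cons_val_zero,
        Matrix.cons_val_one] at h1
      exact ⟨U j 0 0 * x * y + U j 0 1 * w, by
        rw [← h1, add_mul, mul_assoc, hx, mul_assoc, hw, add_mul, hy]
        simp only [mul_assoc]⟩
    refine ⟨S', hS', H.isUnit_right, Nat.le_add_left _ _, le_rfl, hdiag, fun i => ?_,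
      fun i j hij => ?_⟩
    · split_ifs with hi
      · obtain ⟨d, hd⟩ := (hgcrd ⟨i, hi⟩).dvd_right
        intro h0
        exact hz0 (by rw [hd, h0, mul_zero])
      · exact hz0
    -- The chain passes from gcrd to gcrd, then from the last gcrd to `z`, then from `z` to `z`.
    · by_cases hj : j.val < κ
      · rw [dif_pos hj, dif_pos (show i.val < κ by omega)]
        exact hgg _ _ hij
      · rw [dif_neg hj]
        split_ifs with hi
        exacts [hgz _, hself]
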